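/- **Theorem 5.3.** Let $\mathbb H^2_+(\mathbb T)\subset L^2(\mathbb T)$ be the Hardy space of functions whose Fourier coefficients with negative index vanish, and let $\mathbf m$ be the Lebesgue measure on the unit circle $\mathbb T$ normalized by $\mathbf m(\mathbb T)=1$. A bounded operator $\mathbf G$ in $\mathbb H^2_+(\mathbb T)$ is called the Hankel operator with symbol $\omega\in L^\infty(\mathbb T)$ if $$(\mathbf G u,u)=\int_{\mathbb T}\omega(\mu)\,u(\bar\mu)\,\overline{u(\mu)}\,d\mathbf m(\mu)\qquad\text{for all }u\in\mathbb H^2_+(\mathbb T).$$ Let $\mathbf G$ be a self-adjoint Hankel operator in $\mathbb H^2_+(\mathbb T)$ with symbol $$\omega(\zeta)=R_1(\zeta)+\sum_{m=2}^{M}R_m(\zeta)(\zeta-\gamma_m)^{-K_m-1},$$ where the numbers $\gamma_m\in\mathbb C$ ($2\le m\le M$) are pairwise distinct, $|\gamma_m|>1$, $K_m\ge 0$ are integers, and $R_1,\dots,R_M$ are complex polynomials with $\deg R_m\le K_m$ and $R_m(\gamma_m)\ne0$ for $m\ge2$; put $K_1=\deg R_1$ if $R_1\neq 0$. Number the $\gamma_m$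 so that, for some $M_0\ge1$ and $M_1\ge0$ with $M_0+M_1\le M$, $\operatorname{Im}\gamma_m=0$ for $2\le m\le M_0$, $\operatorname{Im}\gamma_m<0$ for $M_0+1\le m\le M_0+M_1$, and $\operatorname{Im}\gamma_m>0$ for $M_0+M_1+1\le m\le M$. Set $$\mathsf p_1=R_1^{(K_1)},\qquad \mathsf p_m=-R_m(\gamma_m)\operatorname{sgn}\gamma_m\quad(2\le m\le M_0);$$ these numbers are real because $\mathbf G$ is self-adjoint. For $1\le m\le M_0$ (for $2\le m\le M_0$ if $R_1=0$) define $\mathcal N^{(m)}_\pm$ by $$\begin{aligned} \mathcal N^{(m)}_+=\mathcal N^{(m)}_-&=(K_m+1)/2 &&\text{if }K_m\text{ is odd},\\ \mathcal N^{(m)}_+-1=\mathcal N^{(m)}_-&=K_m/2 &&\text{if }K_m\text{ is even and }\mathsf p_m>0,\\ \mathcal N^{(m)}_+=\mathcal N^{(m)}_--1&=K_m/2 &&\text{if }K_m\text{ is even and }\mathsf p_m<0. \end{aligned}$$ Then the total numbers $N_\pm(\mathbf G)$ of (strictly) positive and negative eigenvalues of $\mathbf G$, counted with multiplicity, are $$N_\pm(\mathbf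 G)=\sum_{m=1}^{M_0}\mathcal N^{(m)}_\pm+\sum_{m=M_0+1}^{M_0+M_1}K_m+M_1,$$ where the first sum starts with $m=2$ if $R_1=0$. -/

import Mathlib

open MeasureTheory AddCircle
open scoped Polynomial ComplexConjugate ENNReal

noncomputable section

/-- `L²(𝕋)`. The unit circle is parametrized by `t ∈ ℝ/ℤ`, `μ = toCircle t = exp(2πit)`, and carries
the Lebesgue measure normalized to have total mass `1`. Complex conjugation `μ ↦ μ̄` is `t ↦ -t`. -/
abbrev L2Circle : Type := Lp ℂ 2 (haarAddCircle : Measure UnitAddCircle)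

lemma fourierCoeff_eq_inner (f : L2Circle) (n : ℤ) :
    fourierCoeff (f : UnitAddCircle → ℂ) n = inner ℂ (fourierLp (T := 1) 2 n) f := by
  rw [← fourierBasis_repr, HilbertBasis.repr_apply_apply, coe_fourierBasis]

/-- The Hardy space `ℍ²₊(𝕋) ⊂ L²(𝕋)`: the functions whose Fourier coefficients of negative index
vanish (the boundary values of the analytic functions `∑_{n ≥ 0} ξₙ zⁿ` with `∑ |ξₙ|² < ∞`). -/
def hardyCircle : Submodule ℂ L2Circle where
  carrier := {f | ∀ n : ℤ, n < 0 → fourierCoeff (f : UnitAddCircle → ℂ) n = 0}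
  zero_mem' := fun n _ => by rw [fourierCoeff_eq_inner, inner_zero_right]
  add_mem' := fun {f g} hf hg n hn => by
    have h1 := hf n hn
    have h2 := hg n hn
    rw [fourierCoeff_eq_inner] at h1 h2 ⊢
    rw [inner_add_right, h1, h2, add_zero]
  smul_mem' := fun c f hf n hn => by
    have h1 := hf n hn
    rw [fourierCoeff_eq_inner] at h1 ⊢
    rw [inner_smul_right, h1, mul_zero]

lemma isClosed_hardyCircle : IsClosed (hardyCircle : Set L2Circle) := by
  have h : (hardyCircle : Set L2Circle) =
      ⋂ n : ℤ, ⋂ _ : n < 0, {f | inner ℂ (fourierLp (T := 1) 2 n) f = 0} := by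
    ext f
    simp only [Set.mem_iInter, Set.mem_ofPred_eq, ← fourierCoeff_eq_inner]
    rfl
  rw [h]
  exact isClosed_iInter fun n => isClosed_iInter fun _ =>
    isClosed_eq (continuous_const.inner continuous_id) continuous_const

instance hardyCircle_completeSpace : CompleteSpace hardyCircle :=
  isClosed_hardyCircle.completeSpace_coe

/-- `G` is the Hankel operator in `ℍ²₊(𝕋)` with symbol `ω ∈ L^∞(𝕋)`: its quadratic form is
`(G u, u) = ∫_𝕋 ω(μ) u(μ̄) conj(u(μ)) dm(μ)`. The symbol is given as a function of `μ ∈ ℂ`, of which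
only the values on the unit circle matter. -/
structure IsHankelWithSymbol (ω : ℂ → ℂ) (G : hardyCircle →L[ℂ] hardyCircle) : Prop where
  memLp_symbol :
    MemLp (fun t : UnitAddCircle => ω (toCircle t : ℂ)) ∞ haarAddCircle
  form_eq : ∀ u : hardyCircle, inner ℂ u (G u) =
    ∫ t : UnitAddCircle, ω (toCircle t : ℂ) * (u : L2Circle) (-t) * conj ((u : L2Circle) t)
      ∂haarAddCircle

/-- The rational function `ω(ζ) = R₁(ζ) + ∑_{m=2}^M R_m(ζ) (ζ - γ_m)^{-K_m-1}`. -/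
def rationalSymbol (M : ℕ) (K : ℕ → ℕ) (γ : ℕ → ℂ) (R : ℕ → ℂ[X]) (ζ : ℂ) : ℂ :=
  (R 1).eval ζ + ∑ m ∈ Finset.Icc 2 M, (R m).eval ζ * ((ζ - γ m) ^ (K m + 1))⁻¹

section Multiplicity

variable {E : Type*} [NormedAddCommGroup E] [InnerProductSpace ℂ E]

/-- The number, counted with multiplicity, of strictly positive eigenvalues: the dimension of the
span of all eigenvectors with strictly positive eigenvalue. -/
def numPosEigenvalues (A : E →L[ℂ] E) : Cardinal :=
  Module.rank ℂ
    (⨆ (x : ℝ) (_ : 0 < x), Module.End.eigenspace (A : E →ₗ[ℂ] E) (x : ℂ) : Submodule ℂ E)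

/-- The number, counted with multiplicity, of strictly negative eigenvalues. -/
def numNegEigenvalues (A : E →L[ℂ] E) : Cardinal :=
  Module.rank ℂ
    (⨆ (x : ℝ) (_ : x < 0), Module.End.eigenspace (A : E →ₗ[ℂ] E) (x : ℂ) : Submodule ℂ E)

end Multiplicity

/-- `𝒩₊` for degree `K` and leading number `p ≠ 0`. -/
def calNPos (K : ℕ) (p : ℝ) : ℕ :=
  if Odd K then (K + 1) / 2 else if 0 < p then K / 2 + 1 else K / 2

/-- `𝒩₋` for degree `K` and leading number `p ≠ 0`. -/
def calNNeg (K : ℕ) (p : ℝ) : ℕ :=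
  if Odd K then (K + 1) / 2 else if p < 0 then K / 2 + 1 else K / 2

/-- `p₁ = R₁^{(K₁)}` (a constant if `K₁ = deg R₁`), and `p_m = -R_m(γ_m) sgn γ_m` for a real `γ_m`,
`m ≥ 2`. These numbers are real if the operator is self-adjoint, so that taking real parts
does not change them. -/
def leadingNumber (K : ℕ → ℕ) (γ : ℕ → ℂ) (R : ℕ → ℂ[X]) (m : ℕ) : ℝ :=
  if m = 1 then ((Polynomial.derivative^[K 1] (R 1)).eval 0).re
  else -((R m).eval (γ m)).re * Real.sign (γ m).re

open Classical in
/-- The index at which the sum over the real terms starts: `1`, or `2` if `R₁ = 0`. -/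
def firstRealIndex (R : ℕ → ℂ[X]) : ℕ := if R 1 = 0 then 2 else 1

end

/-! On polynomials the form of `G` is `Λ (r * p̄)`, where `p̄` has the conjugated coefficients and
`Λ f = ∫ ω(μ̄) f(μ) dm(μ)`. By Cauchy's formula `Λ` is a sum of functionals at `0` (if `R 1 ≠ 0`)
and at the points `1/γ_m`, of order exactly `K m` (`exists_isSumOfPointFunctionals`).

Lower bound: the radical of the form is the ideal of `∏ (X - z m) ^ (K m + 1)`, so `N₊ + N₋ = rank G
≥ ∑ (K m + 1)` (`le_rank_add_rank`).

Upper bounds: if the form has one sign on the multiples of `D`, at most `deg D` eigenvalues have the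
opposite sign (`rank_iSup_eigenspace_le_natDegree`). Since `Λ` is real, the `z m` come in conjugate
pairs. It suffices that `D` has `𝒩₋` (for `N₋`) or `𝒩₊` (for `N₊`) zeros at each real point and `K m
+ 1` zeros at one member of each pair. The bounds for `N₊` and `N₋` together do not exceed the lower
bound, so all are equalities. -/

/-! ### Eigenspaces of symmetric operators. -/

section Inertia

variable {E : Type*} [NormedAddCommGroup E] [InnerProductSpace ℂ E]

/-- On the span of the eigenvectors whose eigenvalues have a given sign, the quadratic form of a
symmetric operator is definite. -/
lemma re_inner_pos_of_mem_iSup_eigenspace {A : E →L[ℂ] E} (hA : (A : E →ₗ[ℂ] E).IsSymmetric)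
    {p : ℝ → Prop} {σ : ℝ} (hp : ∀ x, p x → 0 < σ * x) {u : E}
    (hu : u ∈ ⨆ (x : ℝ) (_ : p x), Module.End.eigenspace (A : E →ₗ[ℂ] E) (x : ℂ)) (h0 : u ≠ 0) :
    0 < σ * (inner ℂ u (A u)).re := by
  classical
  rw [iSup_subtype'] at hu
  have hO : OrthogonalFamily ℂ
      (fun x : {x : ℝ // p x} => Module.End.eigenspace (A : E →ₗ[ℂ] E) ((x : ℝ) : ℂ))
      fun x => (Module.End.eigenspace (A : E →ₗ[ℂ] E) ((x : ℝ) : ℂ)).subtypeₗᵢ :=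
    hA.orthogonalFamily_eigenspaces.comp (f := fun x : {x : ℝ // p x} => ((x : ℝ) : ℂ))
      (fun a b h => Subtype.ext (Complex.ofReal_injective h))
  obtain ⟨f, rfl⟩ := (Submodule.mem_iSup_iff_exists_dfinsupp' _ u).1 hu
  have hsum : (f.sum fun _ xi => (xi : E)) = ∑ i ∈ f.support, (f i : E) := rfl
  rw [hsum] at h0 ⊢
  have hAf : A (∑ i ∈ f.support, (f i : E)) =
      ∑ i ∈ f.support, ((((i : ℝ) : ℂ) • f i : Module.End.eigenspace (A : E →ₗ[ℂ] E) _) : E) := by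
    rw [map_sum]
    refine Finset.sum_congr rfl fun i _ => ?_
    exact Module.End.mem_eigenspace_iff.1 (f i).2
  have key := hO.inner_sum (fun i => f i) (fun i => ((i : ℝ) : ℂ) • f i) f.support
  simp only [Submodule.coe_subtypeₗᵢ, Submodule.coe_subtype] at key
  rw [hAf, key, Complex.re_sum, Finset.mul_sum]
  have hterm : ∀ i : {x : ℝ // p x}, σ * (inner ℂ (f i) (((i : ℝ) : ℂ) • f i)).re
      = σ * i * ‖f i‖ ^ 2 := by
    intro i
    rw [inner_smul_right, Complex.re_ofReal_mul, mul_assoc]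
    congr 2
    exact inner_self_eq_norm_sq (𝕜 := ℂ) (f i)
  refine Finset.sum_pos (fun i hi => ?_) ?_
  · rw [hterm]
    have : f i ≠ 0 := DFinsupp.mem_support_iff.1 hi
    have := hp i i.2
    positivity
  · by_contra hne
    rw [Finset.not_nonempty_iff_eq_empty] at hne
    simp [hne] at h0

/-- `F` embeds into `V ⧸ N`, and `W` maps onto it. -/
lemma rank_le_of_disjoint_of_sup_eq_top {V : Type*} [AddCommGroup V] [Module ℂ V]
    {F N W : Submodule ℂ V} (hFN : F ⊓ N = ⊥) (hNW : N ⊔ W = ⊤) :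
    Module.rank ℂ F ≤ Module.rank ℂ W := by
  have h1 : Function.Injective (N.mkQ.comp F.subtype) := by
    rw [← LinearMap.ker_eq_bot, LinearMap.ker_eq_bot']
    intro x hx
    have hx' : (x : V) ∈ N := by simpa using hx
    have : (x : V) ∈ F ⊓ N := ⟨x.2, hx'⟩
    rw [hFN] at this
    exact Subtype.ext (by simpa using this)
  have h2 : Function.Surjective (N.mkQ.comp W.subtype) := by
    intro y
    obtain ⟨v, rfl⟩ := N.mkQ_surjective y
    have hv : v ∈ N ⊔ W := by rw [hNW]; trivial
    obtain ⟨a, ha, b, hb, rfl⟩ := Submodule.mem_sup.1 hv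
    refine ⟨⟨b, hb⟩, ?_⟩
    have : N.mkQ a = 0 := by simpa using ha
    simp only [LinearMap.comp_apply, Submodule.subtype_apply, map_add, this, zero_add]
  exact (LinearMap.rank_le_of_injective _ h1).trans (LinearMap.rank_le_of_surjective _ h2)

/-- The restriction to the finite-dimensional range is diagonalizable with real eigenvalues; zero
does not occur, since the kernel is orthogonal to the range. -/
lemma range_le_iSup_eigenspace_pos_sup_neg {A : E →L[ℂ] E}
    (hA : (A : E →ₗ[ℂ] E).IsSymmetric) [FiniteDimensional ℂ (LinearMap.range (A : E →ₗ[ℂ] E))] :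
    LinearMap.range (A : E →ₗ[ℂ] E) ≤
      (⨆ (x : ℝ) (_ : 0 < x), Module.End.eigenspace (A : E →ₗ[ℂ] E) (x : ℂ)) ⊔
        ⨆ (x : ℝ) (_ : x < 0), Module.End.eigenspace (A : E →ₗ[ℂ] E) (x : ℂ) := by
  set B : E →ₗ[ℂ] E := (A : E →ₗ[ℂ] E)
  set F := LinearMap.range B
  have hinv : ∀ v ∈ F, B v ∈ F := fun v _ => LinearMap.mem_range_self B v
  have hT : (B.restrict hinv).IsSymmetric := hA.restrict_invariant hinv
  have htop : ⨆ μ : ℂ, Module.End.eigenspace (B.restrict hinv) μ = ⊤ := by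
    rw [← Submodule.orthogonal_eq_bot_iff]
    exact hT.orthogonalComplement_iSup_eigenspaces_eq_bot
  have hF : F = ⨆ μ : ℂ, (Module.End.eigenspace (B.restrict hinv) μ).map F.subtype := by
    rw [← Submodule.map_iSup, htop, Submodule.map_top, Submodule.range_subtype]
  rw [hF]
  refine iSup_le fun μ => ?_
  rintro _ ⟨v, hv, rfl⟩
  rcases eq_or_ne v 0 with rfl | hv0
  · simp
  have hconj := hT.conj_eigenvalue_eq_self
    (Module.End.hasEigenvalue_of_hasEigenvector ⟨hv, hv0⟩)
  obtain ⟨x, rfl⟩ := Complex.conj_eq_iff_real.1 hconj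
  have hBv : B v = (x : ℂ) • (v : E) := congrArg Subtype.val (Module.End.mem_eigenspace_iff.1 hv)
  have hmem : F.subtype v ∈ Module.End.eigenspace B (x : ℂ) := Module.End.mem_eigenspace_iff.2 hBv
  have hx : x ≠ 0 := by
    rintro rfl
    apply hv0
    obtain ⟨w, hw⟩ := v.2
    have h0 : inner ℂ (v : E) (v : E) = 0 := by
      nth_rewrite 1 [← hw]
      rw [hA w v, hBv]
      simp
    exact Subtype.ext (inner_self_eq_zero.1 h0)
  rcases lt_or_gt_of_ne hx with h | h
  · exact Submodule.mem_sup_right (Submodule.mem_iSup_of_mem x (Submodule.mem_iSup_of_mem h hmem))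
  · exact Submodule.mem_sup_left (Submodule.mem_iSup_of_mem x (Submodule.mem_iSup_of_mem h hmem))

end Inertia

/-! ### Functionals on polynomials supported at finitely many points. -/

/-- `Λ` is a sum of functionals `L m` on `ℂ[X]` concentrated at distinct points `z m`: each of them
vanishes on the multiples of `(X - z m) ^ (K m + 1)` but not on those of `(X - z m) ^ K m`. -/
structure IsSumOfPointFunctionals {ι : Type*} (s : Finset ι) (z : ι → ℂ) (K : ι → ℕ) (c : ι → ℂ)
    (L : ι → ℂ[X] →ₗ[ℂ] ℂ) (Λ : ℂ[X] →ₗ[ℂ] ℂ) : Prop where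
  injOn : Set.InjOn z s
  apply_mul : ∀ m ∈ s, ∀ g : ℂ[X],
    L m ((Polynomial.X - Polynomial.C (z m)) ^ K m * g) = c m * g.eval (z m)
  ne_zero : ∀ m ∈ s, c m ≠ 0
  sum_eq : ∀ f, Λ f = ∑ m ∈ s, L m f

namespace IsSumOfPointFunctionals

open Polynomial

variable {ι : Type*} {s : Finset ι} {z : ι → ℂ} {K : ι → ℕ} {c : ι → ℂ}
  {L : ι → ℂ[X] →ₗ[ℂ] ℂ} {Λ : ℂ[X] →ₗ[ℂ] ℂ}

lemma apply_eq_zero_of_dvd (h : IsSumOfPointFunctionals s z K c L Λ) {m : ι} (hm : m ∈ s)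
    {f : ℂ[X]} (hf : (X - C (z m)) ^ (K m + 1) ∣ f) : L m f = 0 := by
  obtain ⟨g, rfl⟩ := hf
  rw [pow_succ, mul_assoc, h.apply_mul m hm]
  simp

lemma apply_eq_zero_of_prod_dvd (h : IsSumOfPointFunctionals s z K c L Λ) {f : ℂ[X]}
    (hf : ∏ m ∈ s, (X - C (z m)) ^ (K m + 1) ∣ f) : Λ f = 0 := by
  rw [h.sum_eq]
  exact Finset.sum_eq_zero fun m hm =>
    h.apply_eq_zero_of_dvd hm
      ((Finset.dvd_prod_of_mem (fun m => (X - C (z m)) ^ (K m + 1)) hm).trans hf)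

lemma pow_dvd_of_forall_apply_mul_eq_zero (h : IsSumOfPointFunctionals s z K c L Λ) {f : ℂ[X]}
    (hf : ∀ g, Λ (f * g) = 0) {m : ι} (hm : m ∈ s) : (X - C (z m)) ^ (K m + 1) ∣ f := by
  classical
  rcases eq_or_ne f 0 with rfl | hf0
  · exact dvd_zero _
  rw [← le_rootMultiplicity_iff hf0]
  by_contra hlt
  obtain ⟨q, hq, hndvd⟩ := exists_eq_pow_rootMultiplicity_mul_and_not_dvd f hf0 (z m)
  set j := rootMultiplicity (z m) f
  have hj : j + (K m - j) = K m := by omega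
  set Q : ℂ[X] := ∏ i ∈ s.erase m, (X - C (z i)) ^ (K i + 1) with hQ
  -- This test polynomial raises the order at `z m` from `j` to exactly `K m`, and `Q` kills the
  -- functionals at all other points, so only a nonzero multiple of `c m` survives.
  have hval := hf ((X - C (z m)) ^ (K m - j) * Q)
  have hrw : f * ((X - C (z m)) ^ (K m - j) * Q) = (X - C (z m)) ^ K m * (q * Q) := by
    rw [hq, ← hj, pow_add, hj]
    ring
  rw [hrw, h.sum_eq, Finset.sum_eq_single_of_mem m hm, h.apply_mul m hm, eval_mul] at hval
  · have hq0 : q.eval (z m) ≠ 0 := fun h0 => hndvd (dvd_iff_isRoot.2 h0)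
    have hQ0 : Q.eval (z m) ≠ 0 := by
      rw [hQ, eval_prod, Finset.prod_ne_zero_iff]
      intro i hi
      have hne : z m ≠ z i := fun h0 =>
        Finset.ne_of_mem_erase hi (h.injOn hm (Finset.mem_of_mem_erase hi) h0).symm
      simp [sub_ne_zero, hne]
    exact mul_ne_zero (h.ne_zero m hm) (mul_ne_zero hq0 hQ0) hval
  · intro i hi him
    refine h.apply_eq_zero_of_dvd hi ?_
    exact ((Finset.dvd_prod_of_mem (fun i => (X - C (z i)) ^ (K i + 1))
      (Finset.mem_erase.2 ⟨him, hi⟩)).mul_left q).mul_left _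

lemma prod_dvd_of_forall_apply_mul_eq_zero (h : IsSumOfPointFunctionals s z K c L Λ) {f : ℂ[X]}
    (hf : ∀ g, Λ (f * g) = 0) : ∏ m ∈ s, (X - C (z m)) ^ (K m + 1) ∣ f := by
  refine Finset.prod_dvd_of_coprime (fun i hi j hj hij => ?_)
    fun m hm => h.pow_dvd_of_forall_apply_mul_eq_zero hf hm
  exact (pairwise_coprime_X_sub_C Function.injective_id
    (fun h0 => hij (h.injOn hi hj h0) : z i ≠ z j)).pow

/-- If `Λ` is real, then the points `z m` come in complex conjugate pairs. -/
lemma exists_conj_eq (h : IsSumOfPointFunctionals s z K c L Λ)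
    (hΛ : ∀ f : ℂ[X], Λ (f.map (starRingEnd ℂ)) = conj (Λ f)) {m : ι} (hm : m ∈ s) :
    ∃ m' ∈ s, conj (z m) = z m' ∧ K m ≤ K m' := by
  classical
  set A : ℂ[X] := ∏ m ∈ s, (X - C (z m)) ^ (K m + 1) with hA
  have hmap : A.map (starRingEnd ℂ) = ∏ m ∈ s, (X - C (conj (z m))) ^ (K m + 1) := by
    simp [hA, Polynomial.map_prod]
  have hdvd : (X - C (z m)) ^ (K m + 1) ∣ A.map (starRingEnd ℂ) := by
    -- As `Λ` is real, conjugating coefficients preserves the radical of the form; hence the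
    -- conjugate of `A` lies in it too.
    refine h.pow_dvd_of_forall_apply_mul_eq_zero (fun g => ?_) hm
    have hg : A.map (starRingEnd ℂ) * g =
        (A * g.map (starRingEnd ℂ)).map (starRingEnd ℂ) := by
      rw [Polynomial.map_mul, Polynomial.map_map]
      simp
    rw [hg, hΛ, h.apply_eq_zero_of_prod_dvd (dvd_mul_right A _), map_zero]
  have hroot : ∃ m' ∈ s, conj (z m') = z m := by
    have h0 : (A.map (starRingEnd ℂ)).eval (z m) = 0 :=
      dvd_iff_isRoot.1 ((dvd_pow_self _ (Nat.succ_ne_zero _)).trans hdvd)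
    rw [hmap, eval_prod, Finset.prod_eq_zero_iff] at h0
    obtain ⟨m', hm', h0⟩ := h0
    refine ⟨m', hm', ?_⟩
    rw [eval_pow] at h0
    have := pow_eq_zero_iff (Nat.succ_ne_zero _) |>.1 h0
    simp only [eval_sub, eval_X, eval_C, sub_eq_zero] at this
    exact this.symm
  obtain ⟨m', hm', hz⟩ := hroot
  refine ⟨m', hm', by rw [← hz, Complex.conj_conj], ?_⟩
  rw [hmap, ← Finset.mul_prod_erase s _ hm', hz] at hdvd
  have hcop : IsCoprime ((X - C (z m)) ^ (K m + 1))
      (∏ i ∈ s.erase m', (X - C (conj (z i))) ^ (K i + 1)) := by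
    refine IsCoprime.prod_right fun i hi => IsCoprime.pow ?_
    refine pairwise_coprime_X_sub_C Function.injective_id ?_
    intro h0
    refine Finset.ne_of_mem_erase hi (h.injOn (Finset.mem_of_mem_erase hi) hm' ?_)
    exact (starRingEnd ℂ).injective (by simpa [hz] using h0.symm)
  have := (pow_dvd_pow_iff (X_sub_C_ne_zero _) (not_isUnit_X_sub_C _)).1
    (hcop.dvd_of_dvd_mul_right hdvd)
  omega

/-- Nonnegativity of `f ↦ Λ (f f̄)` on the multiples of `∏ (X - z m) ^ b m`. -/
lemma re_apply_mul_conj_nonneg (h : IsSumOfPointFunctionals s z K c L Λ) {b : ι → ℕ} {σ : ℝ}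
    (hb : ∀ m ∈ s, (conj (z m) = z m ∧ ∃ k, K m = 2 * k ∧ k ≤ b m ∧ 0 ≤ σ * (c m).re) ∨
      ∃ m' ∈ s, conj (z m) = z m' ∧ K m + 1 ≤ b m + b m')
    {f : ℂ[X]} (hf : ∏ m ∈ s, (X - C (z m)) ^ b m ∣ f) :
    0 ≤ σ * (Λ (f * f.map (starRingEnd ℂ))).re := by
  rw [h.sum_eq, Complex.re_sum, Finset.mul_sum]
  refine Finset.sum_nonneg fun m hm => ?_
  have hdvd : ∀ i ∈ s, (X - C (z i)) ^ b i ∣ f := fun i hi =>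
    (Finset.dvd_prod_of_mem (fun m => (X - C (z m)) ^ b m) hi).trans hf
  have hdvd' : ∀ i ∈ s, (X - C (conj (z i))) ^ b i ∣ f.map (starRingEnd ℂ) := fun i hi => by
    have := Polynomial.map_dvd (starRingEnd ℂ) (hdvd i hi)
    simpa using this
  -- At a real point of even order `2 * k` the term is `c m * |g (z m)|²`. Otherwise `f` and its
  -- conjugate together vanish at `z m` to order at least `b m + b m'`, and the term is zero.
  rcases hb m hm with ⟨hreal, k, hk, hkb, hσ⟩ | ⟨m', hm', hz, hK⟩
  · obtain ⟨g, rfl⟩ := (pow_dvd_pow _ hkb).trans (hdvd m hm)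
    have hrw : (X - C (z m)) ^ k * g * ((X - C (z m)) ^ k * g).map (starRingEnd ℂ) =
        (X - C (z m)) ^ K m * (g * g.map (starRingEnd ℂ)) := by
      simp only [Polynomial.map_mul, Polynomial.map_pow, Polynomial.map_sub, map_X, map_C, hreal,
        hk, two_mul, pow_add]
      ring
    have hev : (g.map (starRingEnd ℂ)).eval (z m) = conj (g.eval (z m)) := by
      conv_lhs => rw [← hreal]
      rw [eval_map_apply]
    rw [hrw, h.apply_mul m hm, eval_mul, hev, Complex.mul_conj, Complex.re_mul_ofReal, ← mul_assoc]
    exact mul_nonneg hσ (Complex.normSq_nonneg _)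
  · rw [h.apply_eq_zero_of_dvd hm, Complex.zero_re, mul_zero]
    have hzm : conj (z m') = z m := by rw [← hz, Complex.conj_conj]
    have h1 := hdvd m hm
    have h2 := hdvd' m' hm'
    rw [hzm] at h2
    exact (pow_dvd_pow _ hK).trans (by rw [pow_add]; exact mul_dvd_mul h1 h2)

end IsSumOfPointFunctionals

/-! ### Operators whose form on a dense image of the polynomials is given by a functional. -/

section PolynomialModel

open Polynomial

variable {H : Type*} [NormedAddCommGroup H] [InnerProductSpace ℂ H]
  {Φ : ℂ[X] →ₗ[ℂ] H} {G : H →L[ℂ] H} {Λ : ℂ[X] →ₗ[ℂ] ℂ}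

/-- Division by `D` puts every `Φ f` into the sum, which is closed because its second summand is
finite-dimensional. -/
lemma topologicalClosure_map_mulLeft_sup_eq_top (hΦ : DenseRange Φ) {D : ℂ[X]} (hD : D.Monic) :
    ((LinearMap.range (LinearMap.mulLeft ℂ D)).map Φ).topologicalClosure ⊔
      (degreeLT ℂ D.natDegree).map Φ = ⊤ := by
  set N := ((LinearMap.range (LinearMap.mulLeft ℂ D)).map Φ).topologicalClosure
  have : FiniteDimensional ℂ (degreeLT ℂ D.natDegree) :=
    (degreeLTEquiv ℂ D.natDegree).symm.finiteDimensional
  have hclosed : IsClosed ((N ⊔ (degreeLT ℂ D.natDegree).map Φ : Submodule ℂ H) : Set H) :=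
    Submodule.isClosed_sup_finiteDimensional _ _ (Submodule.isClosed_topologicalClosure _)
  rw [← hclosed.submodule_topologicalClosure_eq, ← Submodule.dense_iff_topologicalClosure_eq_top]
  refine hΦ.mono ?_
  rintro _ ⟨f, rfl⟩
  rw [← modByMonic_add_div f D, map_add, add_comm]
  refine Submodule.add_mem_sup ?_ ?_
  · exact Submodule.le_topologicalClosure _ ⟨_, ⟨f /ₘ D, rfl⟩, rfl⟩
  · refine ⟨_, ?_, rfl⟩
    rw [SetLike.mem_coe, mem_degreeLT, ← degree_eq_natDegree hD.ne_zero]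
    exact degree_modByMonic_lt f hD

lemma rank_degreeLT (n : ℕ) : Module.rank ℂ (degreeLT ℂ n) = n := by
  rw [(degreeLTEquiv ℂ n).rank_eq, rank_fin_fun]

lemma rank_map_degreeLT_le (n : ℕ) : Module.rank ℂ ((degreeLT ℂ n).map Φ) ≤ n := by
  simpa [rank_degreeLT] using lift_rank_map_le Φ (degreeLT ℂ n)

/-- If the quadratic form of `σ • G` is nonnegative on the multiples of `D`, then the spectral
subspace on which it is negative definite has dimension at most `deg D`. -/
lemma rank_iSup_eigenspace_le_natDegree (hΦ : DenseRange Φ)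
    (hsym : (G : H →ₗ[ℂ] H).IsSymmetric)
    (hform : ∀ p r, inner ℂ (Φ p) (G (Φ r)) = Λ (r * p.map (starRingEnd ℂ)))
    {D : ℂ[X]} (hD : D.Monic) {σ : ℝ}
    (hpos : ∀ f, D ∣ f → 0 ≤ σ * (Λ (f * f.map (starRingEnd ℂ))).re)
    {p : ℝ → Prop} (hp : ∀ x, p x → 0 < -σ * x) :
    Module.rank ℂ
      (⨆ (x : ℝ) (_ : p x), Module.End.eigenspace (G : H →ₗ[ℂ] H) (x : ℂ) : Submodule ℂ H) ≤
      D.natDegree := by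
  refine (rank_le_of_disjoint_of_sup_eq_top ?_
    (topologicalClosure_map_mulLeft_sup_eq_top hΦ hD)).trans (rank_map_degreeLT_le _)
  rw [Submodule.eq_bot_iff]
  rintro u ⟨hu, huN⟩
  by_contra h0
  have hneg := re_inner_pos_of_mem_iSup_eigenspace hsym hp hu h0
  have hclosed : IsClosed {u : H | 0 ≤ σ * (inner ℂ u (G u)).re} := by
    refine isClosed_le continuous_const (continuous_const.mul (Complex.continuous_re.comp ?_))
    exact continuous_id.inner G.continuous
  -- Nonnegativity passes from the multiples of `D` to their closure, against the strict sign in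
  -- `hneg`.
  have hnonneg : 0 ≤ σ * (inner ℂ u (G u)).re := by
    refine closure_minimal ?_ hclosed huN
    rintro _ ⟨_, ⟨g, rfl⟩, rfl⟩
    simp only [Set.mem_ofPred_eq, hform]
    exact hpos _ (Dvd.intro g rfl)
  linarith

variable {ι : Type*} {s : Finset ι} {z : ι → ℂ} {K : ι → ℕ} {c : ι → ℂ} {L : ι → ℂ[X] →ₗ[ℂ] ℂ}

lemma monic_prod_X_sub_C_pow (s : Finset ι) (z : ι → ℂ) (b : ι → ℕ) :
    (∏ m ∈ s, (X - C (z m)) ^ b m).Monic :=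
  monic_prod_of_monic _ _ fun m _ => (monic_X_sub_C (z m)).pow _

lemma natDegree_prod_X_sub_C_pow (s : Finset ι) (z : ι → ℂ) (b : ι → ℕ) :
    (∏ m ∈ s, (X - C (z m)) ^ b m).natDegree = ∑ m ∈ s, b m := by
  rw [natDegree_prod_of_monic _ _ fun m _ => (monic_X_sub_C (z m)).pow _]
  simp

lemma IsSumOfPointFunctionals.finiteDimensional_range
    (h : IsSumOfPointFunctionals s z K c L Λ) (hΦ : DenseRange Φ)
    (hform : ∀ p r, inner ℂ (Φ p) (G (Φ r)) = Λ (r * p.map (starRingEnd ℂ))) :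
    FiniteDimensional ℂ (LinearMap.range (G : H →ₗ[ℂ] H)) := by
  set A : ℂ[X] := ∏ m ∈ s, (X - C (z m)) ^ (K m + 1)
  have hA : A.Monic := monic_prod_X_sub_C_pow s z fun m => K m + 1
  have hfin : FiniteDimensional ℂ (degreeLT ℂ A.natDegree) :=
    (degreeLTEquiv ℂ A.natDegree).symm.finiteDimensional
  have htop := topologicalClosure_map_mulLeft_sup_eq_top hΦ hA
  have hker : ((LinearMap.range (LinearMap.mulLeft ℂ A)).map Φ).topologicalClosure ≤
      LinearMap.ker (G : H →ₗ[ℂ] H) := by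
    refine Submodule.topologicalClosure_minimal _ ?_ (ContinuousLinearMap.isClosed_ker G)
    rintro _ ⟨_, ⟨g, rfl⟩, rfl⟩
    rw [LinearMap.mem_ker]
    refine hΦ.eq_zero_of_inner_right ℂ fun p => ?_
    refine (hform p _).trans (h.apply_eq_zero_of_prod_dvd ?_)
    exact (Dvd.intro g rfl).mul_right _
  have hrange : LinearMap.range (G : H →ₗ[ℂ] H) ≤
      ((degreeLT ℂ A.natDegree).map Φ).map (G : H →ₗ[ℂ] H) := by
    rw [LinearMap.range_eq_map, ← htop, Submodule.map_sup, sup_le_iff]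
    refine ⟨?_, le_rfl⟩
    rw [LinearMap.le_ker_iff_map.1 hker]
    exact bot_le
  exact Submodule.finiteDimensional_of_le hrange

/-- A polynomial killed by `G ∘ Φ` is a multiple of a polynomial of degree `∑ (K m + 1)`, so `G ∘ Φ`
is injective below that degree. -/
lemma IsSumOfPointFunctionals.le_rank_range
    (h : IsSumOfPointFunctionals s z K c L Λ)
    (hform : ∀ p r, inner ℂ (Φ p) (G (Φ r)) = Λ (r * p.map (starRingEnd ℂ))) :
    ((∑ m ∈ s, (K m + 1) : ℕ) : Cardinal) ≤
      Module.rank ℂ (LinearMap.range (G : H →ₗ[ℂ] H)) := by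
  set n := ∑ m ∈ s, (K m + 1) with hn
  let T : degreeLT ℂ n →ₗ[ℂ] LinearMap.range (G : H →ₗ[ℂ] H) :=
    (G : H →ₗ[ℂ] H).rangeRestrict ∘ₗ Φ ∘ₗ (degreeLT ℂ n).subtype
  have hT : Function.Injective T := by
    rw [← LinearMap.ker_eq_bot, LinearMap.ker_eq_bot']
    rintro ⟨f, hf⟩ hTf
    have hGf : G (Φ f) = 0 := congrArg Subtype.val hTf
    have hdvd := h.prod_dvd_of_forall_apply_mul_eq_zero (f := f) fun g => by
      have := hform (g.map (starRingEnd ℂ)) f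
      rw [hGf, inner_zero_right, Polynomial.map_map] at this
      simpa using this.symm
    refine Subtype.ext (eq_zero_of_dvd_of_degree_lt hdvd ?_)
    rw [degree_eq_natDegree (monic_prod_X_sub_C_pow s z fun m => K m + 1).ne_zero,
      natDegree_prod_X_sub_C_pow s z fun m => K m + 1]
    exact mem_degreeLT.1 hf
  have := LinearMap.lift_rank_le_of_injective T hT
  simpa [rank_degreeLT] using this

/-- `σ • G` has at most `∑ b m` negative eigenvalues, for suitable exponents `b m`. -/
lemma IsSumOfPointFunctionals.rank_iSup_eigenspace_le
    (h : IsSumOfPointFunctionals s z K c L Λ) (hΦ : DenseRange Φ)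
    (hsym : (G : H →ₗ[ℂ] H).IsSymmetric)
    (hform : ∀ p r, inner ℂ (Φ p) (G (Φ r)) = Λ (r * p.map (starRingEnd ℂ)))
    {b : ι → ℕ} {σ : ℝ}
    (hb : ∀ m ∈ s, (conj (z m) = z m ∧ ∃ k, K m = 2 * k ∧ k ≤ b m ∧ 0 ≤ σ * (c m).re) ∨
      ∃ m' ∈ s, conj (z m) = z m' ∧ K m + 1 ≤ b m + b m')
    {p : ℝ → Prop} (hp : ∀ x, p x → 0 < -σ * x) :
    Module.rank ℂ
      (⨆ (x : ℝ) (_ : p x), Module.End.eigenspace (G : H →ₗ[ℂ] H) (x : ℂ) : Submodule ℂ H) ≤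
      ((∑ m ∈ s, b m : ℕ) : Cardinal) := by
  rw [← natDegree_prod_X_sub_C_pow s z b]
  exact rank_iSup_eigenspace_le_natDegree hΦ hsym hform (monic_prod_X_sub_C_pow s z b)
    (fun f hf => h.re_apply_mul_conj_nonneg hb hf) hp

lemma IsSumOfPointFunctionals.le_rank_add_rank
    (h : IsSumOfPointFunctionals s z K c L Λ) (hΦ : DenseRange Φ)
    (hsym : (G : H →ₗ[ℂ] H).IsSymmetric)
    (hform : ∀ p r, inner ℂ (Φ p) (G (Φ r)) = Λ (r * p.map (starRingEnd ℂ))) :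
    ((∑ m ∈ s, (K m + 1) : ℕ) : Cardinal) ≤ numPosEigenvalues G + numNegEigenvalues G := by
  have := h.finiteDimensional_range hΦ hform
  exact ((h.le_rank_range hform).trans
    (Submodule.rank_mono (range_le_iSup_eigenspace_pos_sup_neg hsym))).trans
    (Submodule.rank_add_le_rank_add_rank _ _)

/-- A symmetric operator induces a real functional. -/
lemma apply_map_conj_eq (hsym : (G : H →ₗ[ℂ] H).IsSymmetric)
    (hform : ∀ p r, inner ℂ (Φ p) (G (Φ r)) = Λ (r * p.map (starRingEnd ℂ))) (f : ℂ[X]) :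
    Λ (f.map (starRingEnd ℂ)) = conj (Λ f) := by
  have h1 := hform 1 f
  have h2 := hform f 1
  rw [Polynomial.map_one, mul_one] at h1
  rw [one_mul] at h2
  rw [← h1, ← h2, inner_conj_symm]
  exact (hsym _ _).symm

/-- Polarization for the Hankel form on polynomials. -/
lemma inner_apply_eq_of_quadratic_form
    (hq : ∀ p, inner ℂ (Φ p) (G (Φ p)) = Λ (p * p.map (starRingEnd ℂ))) (p r : ℂ[X]) :
    inner ℂ (Φ p) (G (Φ r)) = Λ (r * p.map (starRingEnd ℂ)) := by
  have h1 := hq (p + r)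
  have h2 := hq (p + Complex.I • r)
  have hI : (Complex.I • r).map (starRingEnd ℂ) = (-Complex.I) • r.map (starRingEnd ℂ) := by
    rw [smul_eq_C_mul, smul_eq_C_mul, Polynomial.map_mul, map_C, Complex.conj_I]
  simp only [map_add, Polynomial.map_add, inner_add_left, inner_add_right, mul_add, add_mul,
    hq p, hq r] at h1
  simp only [map_add, map_smul, hI, Polynomial.map_add, inner_add_left, inner_add_right, mul_add,
    add_mul, inner_smul_left, inner_smul_right, smul_mul_assoc, mul_smul_comm, smul_eq_mul,
    hq p, hq r, Complex.conj_I] at h2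
  -- For the defect `B` of the identity, `h1` says `B(p,r) + B(r,p) = 0` and `h2` says `i B(p,r) - i
  -- B(r,p) = 0`.
  have h3 : Complex.I * (inner ℂ (Φ p) (G (Φ r)) - Λ (r * p.map (starRingEnd ℂ))) = 0 := by
    linear_combination (1 / 2 : ℂ) * h2 + (1 / 2 : ℂ) * Complex.I * h1
  exact sub_eq_zero.1 ((mul_eq_zero.1 h3).resolve_left Complex.I_ne_zero)

end PolynomialModel

/-! ### Polynomials in the Hardy space and integrals over the circle. -/

section Circle

open Polynomial

lemma integral_toCircle_eq_circleAverage (F : ℂ → ℂ) :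
    ∫ t : UnitAddCircle, F (toCircle t : ℂ) ∂haarAddCircle = Real.circleAverage F 0 1 := by
  rw [integral_haarAddCircle, ← UnitAddCircle.intervalIntegral_preimage 0, Real.circleAverage_def,
    inv_one, one_smul, zero_add]
  have h := intervalIntegral.integral_comp_mul_left (a := 0) (b := 1)
    (fun θ : ℝ => F (circleMap 0 1 θ)) (c := 2 * Real.pi) (by positivity)
  rw [mul_zero, mul_one] at h
  rw [← h]
  refine intervalIntegral.integral_congr fun x _ => ?_
  congr 1
  simp [toCircle, Function.Periodic.lift_coe, circleMap]

/-- Cauchy's formula for polynomials. -/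
lemma integral_eval_mul_div_sub {l : ℂ} (hl : ‖l‖ < 1) (h : ℂ[X]) :
    ∫ t : UnitAddCircle, h.eval (toCircle t : ℂ) * ((toCircle t : ℂ) / (toCircle t - l))
      ∂haarAddCircle = h.eval l := by
  rw [integral_toCircle_eq_circleAverage fun w => h.eval w * (w / (w - l))]
  have := DiffContOnCl.circleAverage_smul_div (f := fun w => h.eval w) (c := 0) (R := 1) (w := l)
    (h.differentiable.diffContOnCl) (by simpa using hl)
  simpa [mul_comm] using this

/-- Integration against the normalized Lebesgue measure of the circle. -/
noncomputable def circleIntegralₗ : C(UnitAddCircle, ℂ) →ₗ[ℂ] ℂ where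
  toFun g := ∫ t, g t ∂haarAddCircle
  map_add' f g := integral_add
    (f.continuous.integrable_of_hasCompactSupport (HasCompactSupport.of_compactSpace _))
    (g.continuous.integrable_of_hasCompactSupport (HasCompactSupport.of_compactSpace _))
  map_smul' a _ := integral_const_mul a _

/-- The restriction of a polynomial to the circle. -/
noncomputable def polynomialOnCircle : ℂ[X] →ₐ[ℂ] C(UnitAddCircle, ℂ) :=
  Polynomial.aeval (fourier 1)

lemma polynomialOnCircle_apply (f : ℂ[X]) (t : UnitAddCircle) :
    polynomialOnCircle f t = f.eval (toCircle t : ℂ) := by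
  rw [polynomialOnCircle, aeval_continuousMap_apply, fourier_one]

/-- The functional `f ↦ ∫ g f dm` on polynomials with continuous density `g`. -/
noncomputable def circleFunctional : C(UnitAddCircle, ℂ) →ₗ[ℂ] ℂ[X] →ₗ[ℂ] ℂ :=
  ((LinearMap.mul ℂ C(UnitAddCircle, ℂ)).compl₂ polynomialOnCircle.toLinearMap).compr₂
    circleIntegralₗ

lemma circleFunctional_apply (g : C(UnitAddCircle, ℂ)) (f : ℂ[X]) :
    circleFunctional g f =
      ∫ t : UnitAddCircle, g t * f.eval (toCircle t : ℂ) ∂haarAddCircle := by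
  refine integral_congr_ae (Filter.Eventually.of_forall fun t => ?_)
  change (g * polynomialOnCircle f) t = _
  rw [ContinuousMap.mul_apply, polynomialOnCircle_apply]

lemma toLp_polynomialOnCircle_X_pow (n : ℕ) :
    ContinuousMap.toLp 2 haarAddCircle ℂ (polynomialOnCircle (X ^ n)) = fourierLp (T := 1) 2 n := by
  rw [fourierLp]
  congr 1
  ext t
  rw [polynomialOnCircle_apply, eval_pow, eval_X, fourier_apply, natCast_zsmul, toCircle_nsmul,
    Circle.coe_pow]

lemma toLp_polynomialOnCircle_mem (f : ℂ[X]) :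
    ContinuousMap.toLp 2 haarAddCircle ℂ (polynomialOnCircle f) ∈ hardyCircle := by
  induction f using Polynomial.induction_on' with
  | add p q hp hq => simpa only [map_add] using hardyCircle.add_mem hp hq
  | monomial n a =>
    rw [← C_mul_X_pow_eq_monomial, ← smul_eq_C_mul, map_smul, map_smul,
      toLp_polynomialOnCircle_X_pow]
    refine hardyCircle.smul_mem _ fun k hk => ?_
    rw [fourierCoeff_eq_inner]
    exact orthonormal_fourier.2 (by omega)

/-- Polynomials as elements of the Hardy space. -/
noncomputable def polynomialToHardy : ℂ[X] →ₗ[ℂ] hardyCircle :=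
  ((ContinuousMap.toLp 2 haarAddCircle ℂ).toLinearMap ∘ₗ
    polynomialOnCircle.toLinearMap).codRestrict hardyCircle toLp_polynomialOnCircle_mem

lemma coe_polynomialToHardy (f : ℂ[X]) : (polynomialToHardy f : L2Circle) =
    ContinuousMap.toLp 2 haarAddCircle ℂ (polynomialOnCircle f) := rfl

lemma polynomialToHardy_ae_eq (f : ℂ[X]) :
    ((polynomialToHardy f : L2Circle) : UnitAddCircle → ℂ) =ᵐ[haarAddCircle]
      fun t => f.eval (toCircle t : ℂ) := by
  rw [coe_polynomialToHardy]
  filter_upwards [ContinuousMap.coeFn_toLp (p := 2) (𝕜 := ℂ) haarAddCircle (polynomialOnCircle f)]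
    with t ht
  rw [ht, polynomialOnCircle_apply]

/-- A vector orthogonal to all `X ^ k` has no Fourier coefficients of index `≥ 0`, and membership in
`hardyCircle` excludes the negative ones. -/
lemma denseRange_polynomialToHardy : DenseRange polynomialToHardy := by
  have h : (LinearMap.range polynomialToHardy).topologicalClosure = ⊤ := by
    rw [Submodule.topologicalClosure_eq_top_iff, Submodule.eq_bot_iff]
    intro u hu
    rw [Submodule.mem_orthogonal] at hu
    refine Subtype.ext (fourierBasis.repr.injective ?_)
    ext n
    rw [fourierBasis_repr]
    simp only [ZeroMemClass.coe_zero, map_zero]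
    rcases lt_or_ge n 0 with hn | hn
    · exact u.2 n hn
    · obtain ⟨k, rfl⟩ := Int.eq_ofNat_of_zero_le hn
      rw [fourierCoeff_eq_inner, ← toLp_polynomialOnCircle_X_pow]
      exact hu _ ⟨X ^ k, rfl⟩
  have hd := Submodule.dense_iff_topologicalClosure_eq_top.2 h
  rwa [LinearMap.coe_range] at hd

lemma conj_toCircle_neg (t : UnitAddCircle) :
    conj (toCircle (-t) : ℂ) = toCircle t := by
  rw [toCircle_neg, Circle.coe_inv_eq_conj, Complex.conj_conj]

/-- On polynomials, the form of a Hankel operator is given by a functional of the product. -/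
lemma IsHankelWithSymbol.inner_polynomialToHardy {ω : ℂ → ℂ} {G : hardyCircle →L[ℂ] hardyCircle}
    (hG : IsHankelWithSymbol ω G) {g : C(UnitAddCircle, ℂ)}
    (hg : ∀ t, g t = ω (toCircle (-t) : ℂ)) (p : ℂ[X]) :
    inner ℂ (polynomialToHardy p) (G (polynomialToHardy p)) =
      circleFunctional g (p * p.map (starRingEnd ℂ)) := by
  -- Substituting `t ↦ -t` turns the integrand into `ω(μ̄) p(μ) conj(p(μ̄))`, whose last factor is a
  -- polynomial in `μ`.
  rw [hG.form_eq, circleFunctional_apply, ← integral_neg_eq_self _ haarAddCircle]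
  refine integral_congr_ae ?_
  have h1 := polynomialToHardy_ae_eq p
  have h2 := (Measure.measurePreserving_neg
    (haarAddCircle : Measure UnitAddCircle)).quasiMeasurePreserving.ae_eq_comp h1
  filter_upwards [h1, h2] with t ht1 ht2
  simp only [Function.comp_apply, neg_neg] at ht2 ⊢
  rw [ht1, ht2, hg, eval_mul, mul_assoc]
  congr 2
  conv_rhs => rw [← conj_toCircle_neg t, eval_map_apply]

end Circle

/-! ### The functional of a rational symbol. -/

section RationalSymbol

open Polynomial

lemma eval_reflect_inv_mul_pow {R : ℂ[X]} {k : ℕ} (hR : R.natDegree ≤ k) {x : ℂ} (hx : x ≠ 0) :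
    (R.reflect k).eval x⁻¹ * x ^ k = R.eval x := by
  let := invertibleOfNonzero hx
  simpa [eval₂_id, eval₂_eq_eval_map] using eval₂_reflect_mul_pow (RingHom.id ℂ) x k R hR

/-- On the circle `w ^ k * R(w⁻¹)` is the reflected polynomial, and the integral of a polynomial is
its value at `0`. -/
lemma circleFunctional_polynomial {R : ℂ[X]} {k : ℕ} (hR : R.natDegree ≤ k)
    {g : C(UnitAddCircle, ℂ)} (hg : ∀ t, g t = R.eval (toCircle (-t) : ℂ)) (h : ℂ[X]) :
    circleFunctional g (X ^ k * h) = R.coeff k * h.eval 0 := by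
  have hc : R.coeff k * h.eval 0 = (R.reflect k * h).eval 0 := by
    rw [eval_mul, ← coeff_zero_eq_eval_zero (R.reflect k), coeff_reflect]
    simp
  rw [hc, ← integral_eval_mul_div_sub (l := 0) (by simp), circleFunctional_apply]
  refine integral_congr_ae (Filter.Eventually.of_forall fun t => ?_)
  have hw : (toCircle t : ℂ) ≠ 0 := Circle.coe_ne_zero _
  have hr := eval_reflect_inv_mul_pow hR (inv_ne_zero hw)
  rw [inv_inv] at hr
  simp only [hg, toCircle_neg, Circle.coe_inv, eval_mul, eval_pow, eval_X, sub_zero, ← hr]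
  rw [div_self hw, inv_pow]
  field_simp

/-- Since `w⁻¹ - γ = -γ (w - γ⁻¹) / w`, the factor `(w - γ⁻¹) ^ k` reduces the pole to a simple one,
and Cauchy's formula at `γ⁻¹` applies. -/
lemma circleFunctional_pole {γ : ℂ} (hγ : 1 < ‖γ‖) {R : ℂ[X]} {k : ℕ} (hR : R.natDegree ≤ k)
    {g : C(UnitAddCircle, ℂ)}
    (hg : ∀ t, g t = R.eval (toCircle (-t) : ℂ) * (((toCircle (-t) : ℂ) - γ) ^ (k + 1))⁻¹)
    (h : ℂ[X]) :
    circleFunctional g ((X - C γ⁻¹) ^ k * h) =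
      (-γ⁻¹) ^ (k + 1) * γ⁻¹ ^ k * R.eval γ * h.eval γ⁻¹ := by
  have hγ0 : γ ≠ 0 := norm_pos_iff.1 (by linarith)
  have hc : (-γ⁻¹) ^ (k + 1) * γ⁻¹ ^ k * R.eval γ * h.eval γ⁻¹ =
      (-γ⁻¹) ^ (k + 1) * (R.reflect k * h).eval γ⁻¹ := by
    rw [eval_mul, ← eval_reflect_inv_mul_pow hR hγ0, inv_pow]
    field_simp
  rw [hc, ← integral_eval_mul_div_sub (by rw [norm_inv]; exact inv_lt_one_of_one_lt₀ hγ),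
    circleFunctional_apply, ← integral_const_mul]
  refine integral_congr_ae (Filter.Eventually.of_forall fun t => ?_)
  have hw : (toCircle t : ℂ) ≠ 0 := Circle.coe_ne_zero _
  have hr := eval_reflect_inv_mul_pow hR (inv_ne_zero hw)
  rw [inv_inv] at hr
  simp only [hg, toCircle_neg, Circle.coe_inv, eval_mul, eval_pow, eval_X, eval_sub, eval_C, ← hr]
  set w : ℂ := (toCircle t : ℂ) with hwdef
  have hwl : w - γ⁻¹ ≠ 0 := by
    intro h0
    have h1 : ‖w‖ = 1 := Circle.norm_coe _
    rw [sub_eq_zero.1 h0, norm_inv, inv_eq_one] at h1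
    linarith
  have hfac : w⁻¹ - γ = (-γ⁻¹)⁻¹ * (w⁻¹ * (w - γ⁻¹)) := by
    field_simp
    ring
  rw [hfac]
  simp only [mul_pow, mul_inv, inv_pow, inv_inv]
  generalize w - γ⁻¹ = v at hwl
  rw [pow_succ v, pow_succ w]
  field_simp

lemma continuous_pole {γ : ℂ} (hγ : 1 < ‖γ‖) (R : ℂ[X]) (k : ℕ) :
    Continuous fun t : UnitAddCircle =>
      R.eval (toCircle (-t) : ℂ) * (((toCircle (-t) : ℂ) - γ) ^ (k + 1))⁻¹ := by
  have hc : Continuous fun t : UnitAddCircle => (toCircle (-t) : ℂ) :=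
    continuous_induced_dom.comp (continuous_toCircle.comp continuous_neg)
  refine (R.continuous.comp hc).mul (((hc.sub continuous_const).pow _).inv₀ fun t => ?_)
  refine pow_ne_zero _ fun h0 => ?_
  have h1 : ‖(toCircle (-t) : ℂ)‖ = 1 := Circle.norm_coe _
  have h2 : (toCircle (-t) : ℂ) = γ := sub_eq_zero.1 h0
  rw [h2] at h1
  linarith

/-- The functional of a rational symbol is a sum of functionals concentrated at `0` and at the
inverses of the poles. -/
lemma exists_isSumOfPointFunctionals {M : ℕ} (hM : 1 ≤ M) {K : ℕ → ℕ} {γ : ℕ → ℂ} {R : ℕ → ℂ[X]}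
    (hK₁ : K 1 = (R 1).natDegree)
    (hγ : ∀ m ∈ Finset.Icc 2 M, 1 < ‖γ m‖)
    (hγ_inj : Set.InjOn γ (Set.Icc 2 M))
    (hdeg : ∀ m ∈ Finset.Icc 2 M, (R m).natDegree ≤ K m)
    (hR : ∀ m ∈ Finset.Icc 2 M, (R m).eval (γ m) ≠ 0) :
    ∃ (L : ℕ → ℂ[X] →ₗ[ℂ] ℂ) (g : C(UnitAddCircle, ℂ)),
      (∀ t, g t = rationalSymbol M K γ R (toCircle (-t) : ℂ)) ∧
      IsSumOfPointFunctionals (Finset.Icc (firstRealIndex R) M)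
        (fun m => if m = 1 then 0 else (γ m)⁻¹) K
        (fun m => if m = 1 then (R 1).coeff (K 1) else
          (-(γ m)⁻¹) ^ (K m + 1) * (γ m)⁻¹ ^ K m * (R m).eval (γ m))
        L (circleFunctional g) := by
  set s := Finset.Icc (firstRealIndex R) M
  have hs : ∀ m ∈ s, m = 1 ∧ R 1 ≠ 0 ∨ m ≠ 1 ∧ m ∈ Finset.Icc 2 M := by
    intro m hm
    simp only [s, firstRealIndex, Finset.mem_Icc] at hm ⊢
    split_ifs at hm with h
    · exact Or.inr ⟨by omega, hm⟩
    · rcases eq_or_ne m 1 with h1 | h1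
      · exact Or.inl ⟨h1, h⟩
      · exact Or.inr ⟨h1, by omega, hm.2⟩
  have hex : ∀ m, ∃ G : C(UnitAddCircle, ℂ), m ∈ s → ∀ t, G t =
      if m = 1 then (R 1).eval (toCircle (-t) : ℂ) else
        (R m).eval (toCircle (-t) : ℂ) * (((toCircle (-t) : ℂ) - γ m) ^ (K m + 1))⁻¹ := by
    intro m
    by_cases hm : m ∈ s
    · rcases hs m hm with ⟨rfl, -⟩ | ⟨h1, h2⟩
      · exact ⟨⟨fun t => (R 1).eval (toCircle (-t) : ℂ), (R 1).continuous.comp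
          (continuous_induced_dom.comp (continuous_toCircle.comp continuous_neg))⟩, by simp⟩
      · exact ⟨⟨_, continuous_pole (hγ m h2) (R m) (K m)⟩, by simp [h1]⟩
    · exact ⟨0, fun h => absurd h hm⟩
  choose G hG using hex
  refine ⟨fun m => circleFunctional (G m), ∑ m ∈ s, G m, fun t => ?_, ?_, ?_, ?_, ?_⟩
  · rw [ContinuousMap.sum_apply, Finset.sum_congr rfl fun m hm => hG m hm t, rationalSymbol]
    have hsum : ∀ m ∈ Finset.Icc 2 M, (if m = 1 then (R 1).eval (toCircle (-t) : ℂ) else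
        (R m).eval (toCircle (-t) : ℂ) * (((toCircle (-t) : ℂ) - γ m) ^ (K m + 1))⁻¹) =
        (R m).eval (toCircle (-t) : ℂ) * (((toCircle (-t) : ℂ) - γ m) ^ (K m + 1))⁻¹ := by
      intro m hm
      rw [if_neg (by have := (Finset.mem_Icc.1 hm).1; omega)]
    by_cases h : R 1 = 0
    · have : s = Finset.Icc 2 M := by simp [s, firstRealIndex, h]
      rw [this, Finset.sum_congr rfl hsum, h, eval_zero, zero_add]
    · have : s = insert 1 (Finset.Icc 2 M) := by
        ext m
        simp only [s, firstRealIndex, h, if_false, Finset.mem_Icc, Finset.mem_insert]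
        omega
      rw [this, Finset.sum_insert (by simp), Finset.sum_congr rfl hsum, if_pos rfl]
  · have hγ0 : ∀ m ∈ Finset.Icc 2 M, γ m ≠ 0 := fun m hm =>
      norm_pos_iff.1 (zero_lt_one.trans (hγ m hm))
    intro a ha b hb hab
    rcases hs a ha with ⟨rfl, -⟩ | ⟨ha1, ha2⟩ <;> rcases hs b hb with ⟨rfl, -⟩ | ⟨hb1, hb2⟩
    · rfl
    · exact absurd (by simpa [hb1] using hab.symm) (hγ0 b hb2)
    · exact absurd (by simpa [ha1] using hab) (hγ0 a ha2)
    · refine hγ_inj (Finset.mem_Icc.1 ha2) (Finset.mem_Icc.1 hb2) ?_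
      simpa [ha1, hb1] using hab
  · intro m hm h
    rcases hs m hm with ⟨rfl, -⟩ | ⟨h1, h2⟩
    · have := circleFunctional_polynomial (g := G 1) hK₁.ge (fun t => by simp [hG 1 hm t]) h
      simpa using this
    · have := circleFunctional_pole (hγ m h2) (hdeg m h2) (g := G m)
        (fun t => by simp [hG m hm t, h1]) h
      simpa [h1] using this
  · intro m hm
    rcases hs m hm with ⟨rfl, h⟩ | ⟨h1, h2⟩
    · simpa [hK₁] using h
    · have hγ0 : γ m ≠ 0 := norm_pos_iff.1 (zero_lt_one.trans (hγ m h2))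
      simp [h1, hγ0, hR m h2]
  · intro f
    rw [map_sum, LinearMap.sum_apply]

/-- The sign of `p_m` is that of the coefficient of the functional at the point `m`. -/
lemma exists_pos_re_coeff_eq_mul_leadingNumber {K : ℕ → ℕ} {γ : ℕ → ℂ} {R : ℕ → ℂ[X]} {m : ℕ}
    (hm : m ≠ 1 → (γ m).im = 0 ∧ γ m ≠ 0) (hK : Even (K m)) :
    ∃ r : ℝ, 0 < r ∧ (if m = 1 then (R 1).coeff (K 1) else
      (-(γ m)⁻¹) ^ (K m + 1) * (γ m)⁻¹ ^ K m * (R m).eval (γ m)).re =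
        r * leadingNumber K γ R m := by
  by_cases h1 : m = 1
  · subst h1
    refine ⟨((K 1).factorial : ℝ)⁻¹, by positivity, ?_⟩
    have hev : (derivative^[K 1] (R 1)).eval 0 = ((K 1).factorial : ℂ) * (R 1).coeff (K 1) := by
      rw [← coeff_zero_eq_eval_zero, coeff_iterate_derivative, zero_add, Nat.descFactorial_self,
        nsmul_eq_mul]
    have hre : (((K 1).factorial : ℂ) * (R 1).coeff (K 1)).re =
        ((K 1).factorial : ℝ) * ((R 1).coeff (K 1)).re := by
      rw [← Complex.ofReal_natCast, Complex.re_ofReal_mul]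
    rw [if_pos rfl, leadingNumber, if_pos rfl, hev, hre, inv_mul_cancel_left₀ (by positivity)]
  · obtain ⟨him, h0⟩ := hm h1
    obtain ⟨x, hx⟩ : ∃ x : ℝ, γ m = x := ⟨(γ m).re, Complex.ext rfl (by simpa using him)⟩
    have hx0 : x ≠ 0 := fun h => h0 (by simp [hx, h])
    -- The coefficient is `(-1) ^ (K m + 1) * x⁻¹ ^ (2 * K m + 1) * R_m(x)`: even `K m` gives the
    -- minus sign, and the odd power gives `sgn x`.
    refine ⟨|x|⁻¹ ^ (2 * K m + 1), by positivity, ?_⟩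
    have hc : (-(γ m)⁻¹) ^ (K m + 1) * (γ m)⁻¹ ^ K m = ((-(x⁻¹ ^ (2 * K m + 1)) : ℝ) : ℂ) := by
      rw [hK.add_one.neg_pow, hx]
      push_cast
      ring
    rw [if_neg h1, leadingNumber, if_neg h1, hc, Complex.re_ofReal_mul]
    have hsign : x⁻¹ ^ (2 * K m + 1) = |x|⁻¹ ^ (2 * K m + 1) * Real.sign x := by
      rcases lt_or_gt_of_ne hx0 with h | h
      · rw [abs_of_neg h, Real.sign_of_neg h, inv_neg, Odd.neg_pow ⟨K m, rfl⟩]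
        ring
      · rw [abs_of_pos h, Real.sign_of_pos h, mul_one]
    rw [hsign, hx, Complex.ofReal_re]
    ring

end RationalSymbol

/-! ### Counting. -/

lemma calNPos_add_calNNeg_le (k : ℕ) (p : ℝ) : calNPos k p + calNNeg k p ≤ k + 1 := by
  unfold calNPos calNNeg
  by_cases hk : Odd k
  · obtain ⟨j, rfl⟩ := hk
    rw [if_pos ⟨j, rfl⟩, if_pos ⟨j, rfl⟩]
    omega
  · obtain ⟨j, rfl⟩ := Nat.not_odd_iff_even.1 hk
    rw [if_neg hk, if_neg hk]
    split_ifs with h1 h2 <;> first | linarith | omega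

/-- `f = M₀ + 1` is the case `M₀ = 1`, `R 1 = 0`, where the real block is empty. -/
lemma sum_Icc_ite_eq {f M₀ M₁ M : ℕ} (hf : f ≤ M₀ + 1) (hM : M₀ + M₁ ≤ M) (a b c : ℕ → ℕ) :
    ∑ m ∈ Finset.Icc f M, (if m ≤ M₀ then a m else if m ≤ M₀ + M₁ then b m else c m) =
      ∑ m ∈ Finset.Icc f M₀, a m + ∑ m ∈ Finset.Icc (M₀ + 1) (M₀ + M₁), b m +
        ∑ m ∈ Finset.Icc (M₀ + M₁ + 1) M, c m := by
  have h1 : Finset.Icc f M = (Finset.Icc f M₀ ∪ Finset.Icc (M₀ + 1) (M₀ + M₁)) ∪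
      Finset.Icc (M₀ + M₁ + 1) M := by
    ext m
    simp only [Finset.mem_Icc, Finset.mem_union]
    omega
  rw [h1, Finset.sum_union, Finset.sum_union]
  · congr 1
    · congr 1
      · refine Finset.sum_congr rfl fun m hm => if_pos (Finset.mem_Icc.1 hm).2
      · refine Finset.sum_congr rfl fun m hm => ?_
        rw [Finset.mem_Icc] at hm
        rw [if_neg (by omega), if_pos hm.2]
    · refine Finset.sum_congr rfl fun m hm => ?_
      rw [Finset.mem_Icc] at hm
      rw [if_neg (by omega), if_neg (by omega)]
  · rw [Finset.disjoint_left]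
    intro m
    simp only [Finset.mem_Icc]
    omega
  · rw [Finset.disjoint_left]
    intro m
    simp only [Finset.mem_Icc, Finset.mem_union]
    omega

theorem theorem5p3 (M M₀ M₁ : ℕ) (K : ℕ → ℕ) (γ : ℕ → ℂ) (R : ℕ → ℂ[X])
    (hM₀ : 1 ≤ M₀) (hM : M₀ + M₁ ≤ M)
    (hK₁ : K 1 = (R 1).natDegree)
    (hγ : ∀ m ∈ Finset.Icc 2 M, 1 < ‖γ m‖)
    (hγ_inj : Set.InjOn γ (Set.Icc 2 M))
    (hdeg : ∀ m ∈ Finset.Icc 2 M, (R m).natDegree ≤ K m)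
    (hR : ∀ m ∈ Finset.Icc 2 M, (R m).eval (γ m) ≠ 0)
    (hreal : ∀ m ∈ Finset.Icc 2 M₀, (γ m).im = 0)
    (hneg : ∀ m ∈ Finset.Icc (M₀ + 1) (M₀ + M₁), (γ m).im < 0)
    (hpos : ∀ m ∈ Finset.Icc (M₀ + M₁ + 1) M, 0 < (γ m).im)
    (G : hardyCircle →L[ℂ] hardyCircle)
    (hG : IsHankelWithSymbol (rationalSymbol M K γ R) G)
    (hsa : IsSelfAdjoint G) :
    numPosEigenvalues G =
        ((∑ m ∈ Finset.Icc (firstRealIndex R) M₀, calNPos (K m) (leadingNumber K γ R m)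
          + ∑ m ∈ Finset.Icc (M₀ + 1) (M₀ + M₁), K m + M₁ : ℕ) : Cardinal) ∧
      numNegEigenvalues G =
        ((∑ m ∈ Finset.Icc (firstRealIndex R) M₀, calNNeg (K m) (leadingNumber K γ R m)
          + ∑ m ∈ Finset.Icc (M₀ + 1) (M₀ + M₁), K m + M₁ : ℕ) : Cardinal) := by
  obtain ⟨L, g, hg, hL⟩ := exists_isSumOfPointFunctionals (by omega) hK₁ hγ hγ_inj hdeg hR
  have hsym : (G : hardyCircle →ₗ[ℂ] hardyCircle).IsSymmetric := hsa.isSymmetric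
  have hform := inner_apply_eq_of_quadratic_form (hG.inner_polynomialToHardy hg)
  have hΦ := denseRange_polynomialToHardy
  have hlower := hL.le_rank_add_rank hΦ hsym hform
  set f := firstRealIndex R with hf
  have hf1 : 1 ≤ f ∧ f ≤ 2 := by
    rw [hf, firstRealIndex]
    split_ifs <;> omega
  set z : ℕ → ℂ := fun m => if m = 1 then 0 else (γ m)⁻¹ with hz
  set c : ℕ → ℂ := fun m => if m = 1 then (R 1).coeff (K 1) else
    (-(γ m)⁻¹) ^ (K m + 1) * (γ m)⁻¹ ^ K m * (R m).eval (γ m) with hc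
  set p := leadingNumber K γ R with hp
  have hγ0 : ∀ m ∈ Finset.Icc 2 M, γ m ≠ 0 := fun m hm =>
    norm_pos_iff.1 (zero_lt_one.trans (hγ m hm))
  have hzim : ∀ m, z m = if m = 1 then 0 else (γ m)⁻¹ := fun _ => rfl
  have him_real : ∀ m ∈ Finset.Icc f M, m ≤ M₀ → (z m).im = 0 := by
    intro m hm hle
    rw [Finset.mem_Icc] at hm
    by_cases h1 : m = 1
    · simp [hzim, h1]
    · simp [hzim, h1, Complex.inv_im, hreal m (Finset.mem_Icc.2 ⟨by omega, hle⟩)]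
  have him_neg : ∀ m ∈ Finset.Icc f M, M₀ < m → m ≤ M₀ + M₁ → 0 < (z m).im := by
    intro m hm h1 h2
    rw [Finset.mem_Icc] at hm
    have h0 := Complex.normSq_pos.2 (hγ0 m (Finset.mem_Icc.2 ⟨by omega, hm.2⟩))
    have := hneg m (Finset.mem_Icc.2 ⟨h1, h2⟩)
    rw [hzim, if_neg (by omega), Complex.inv_im]
    exact div_pos (by linarith) h0
  have him_pos : ∀ m ∈ Finset.Icc f M, M₀ + M₁ < m → (z m).im < 0 := by
    intro m hm h1
    rw [Finset.mem_Icc] at hm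
    have h0 := Complex.normSq_pos.2 (hγ0 m (Finset.mem_Icc.2 ⟨by omega, hm.2⟩))
    have := hpos m (Finset.mem_Icc.2 ⟨h1, hm.2⟩)
    rw [hzim, if_neg (by omega), Complex.inv_im]
    exact div_neg_of_neg_of_pos (by linarith) h0
  have hconj : ∀ m ∈ Finset.Icc f M, ∃ m' ∈ Finset.Icc f M, conj (z m) = z m' ∧ K m ≤ K m' :=
    fun m hm => hL.exists_conj_eq (apply_map_conj_eq hsym hform) hm
  have hreal_conj : ∀ m ∈ Finset.Icc f M, m ≤ M₀ → conj (z m) = z m := fun m hm hle =>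
    Complex.conj_eq_iff_im.2 (him_real m hm hle)
  -- Two bounds, according to the half-plane in which `D` has its nonreal zeros. Inversion swaps the
  -- half-planes: `Im γ_m < 0` means `Im z_m > 0`.
  have hupper : ∀ (σ : ℝ) (a : ℕ → ℕ),
      (∀ m ∈ Finset.Icc f M, m ≤ M₀ → K m + 1 ≤ a m + a m ∨
        ∃ k, K m = 2 * k ∧ k ≤ a m ∧ 0 ≤ σ * (c m).re) →
      ∀ q : ℝ → Prop, (∀ x, q x → 0 < -σ * x) →
      Module.rank ℂ (⨆ (x : ℝ) (_ : q x), Module.End.eigenspace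
        (G : hardyCircle →ₗ[ℂ] hardyCircle) (x : ℂ) : Submodule ℂ hardyCircle) ≤
        ((∑ m ∈ Finset.Icc f M₀, a m +
          ∑ m ∈ Finset.Icc (M₀ + 1) (M₀ + M₁), (K m + 1) : ℕ) : Cardinal) ∧
      Module.rank ℂ (⨆ (x : ℝ) (_ : q x), Module.End.eigenspace
        (G : hardyCircle →ₗ[ℂ] hardyCircle) (x : ℂ) : Submodule ℂ hardyCircle) ≤
        ((∑ m ∈ Finset.Icc f M₀, a m +
          ∑ m ∈ Finset.Icc (M₀ + M₁ + 1) M, (K m + 1) : ℕ) : Cardinal) := by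
    intro σ a ha q hq
    constructor
    · have := hL.rank_iSup_eigenspace_le hΦ hsym hform (σ := σ) (p := q)
        (b := fun m => if m ≤ M₀ then a m else if m ≤ M₀ + M₁ then K m + 1 else 0) ?_ hq
      · rw [sum_Icc_ite_eq (by omega) hM] at this
        simpa using this
      intro m hm
      by_cases h1 : m ≤ M₀
      · rcases ha m hm h1 with h | ⟨k, hk1, hk2, hk3⟩
        · exact Or.inr ⟨m, hm, hreal_conj m hm h1, by simpa [h1] using h⟩
        · exact Or.inl ⟨hreal_conj m hm h1, k, hk1, by simpa [h1] using hk2, hk3⟩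
      · obtain ⟨m', hm', hzz, hKK⟩ := hconj m hm
        refine Or.inr ⟨m', hm', hzz, ?_⟩
        by_cases h2 : m ≤ M₀ + M₁
        · simp [h1, h2]
        -- Here `D` has no prescribed zero at `z m`; the conjugate index lies in the middle block
        -- and supplies `K m' + 1 ≥ K m + 1` zeros.
        · have h3 := him_pos m hm (by omega)
          have h4 : (z m').im = -(z m).im := by rw [← hzz, Complex.conj_im]
          have h5 : ¬ m' ≤ M₀ := fun h => by
            have := him_real m' hm' h
            linarith
          have h6 : m' ≤ M₀ + M₁ := by
            by_contra h
            have := him_pos m' hm' (by omega)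
            linarith
          simp only [h1, h2, h5, h6, if_true, if_false]
          omega
    · have := hL.rank_iSup_eigenspace_le hΦ hsym hform (σ := σ) (p := q)
        (b := fun m => if m ≤ M₀ then a m else if m ≤ M₀ + M₁ then 0 else K m + 1) ?_ hq
      · rw [sum_Icc_ite_eq (by omega) hM] at this
        simpa using this
      intro m hm
      by_cases h1 : m ≤ M₀
      · rcases ha m hm h1 with h | ⟨k, hk1, hk2, hk3⟩
        · exact Or.inr ⟨m, hm, hreal_conj m hm h1, by simpa [h1] using h⟩
        · exact Or.inl ⟨hreal_conj m hm h1, k, hk1, by simpa [h1] using hk2, hk3⟩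
      · obtain ⟨m', hm', hzz, hKK⟩ := hconj m hm
        refine Or.inr ⟨m', hm', hzz, ?_⟩
        by_cases h2 : m ≤ M₀ + M₁
        · have h3 := him_neg m hm (by omega) h2
          have h4 : (z m').im = -(z m).im := by rw [← hzz, Complex.conj_im]
          have h5 : ¬ m' ≤ M₀ := fun h => by
            have := him_real m' hm' h
            linarith
          have h6 : ¬ m' ≤ M₀ + M₁ := fun h => by
            have := him_neg m' hm' (by omega) h
            linarith
          simp only [h1, h2, h5, h6, if_true, if_false]
          omega
        · simp [h1, h2]
  have hsign : ∀ m ∈ Finset.Icc f M, m ≤ M₀ → Even (K m) → ∃ r : ℝ, 0 < r ∧ (c m).re = r * p m := by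
    intro m hm hle hK
    rw [Finset.mem_Icc] at hm
    exact exists_pos_re_coeff_eq_mul_leadingNumber (fun h1 =>
      ⟨hreal m (Finset.mem_Icc.2 ⟨by omega, hle⟩), hγ0 m (Finset.mem_Icc.2 ⟨by omega, hm.2⟩)⟩) hK
  obtain ⟨hn1, hn2⟩ : numNegEigenvalues G ≤ _ ∧ numNegEigenvalues G ≤ _ :=
    hupper 1 (fun m => calNNeg (K m) (p m)) (fun m hm hle => by
      dsimp only [calNNeg]
      by_cases hK : Odd (K m)
      · obtain ⟨j, hj⟩ := hK
        rw [if_pos ⟨j, hj⟩]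
        exact Or.inl (by omega)
      · have hK' := Nat.not_odd_iff_even.1 hK
        obtain ⟨r, hr, hcr⟩ := hsign m hm hle hK'
        obtain ⟨j, hj⟩ := hK'
        rw [if_neg hK]
        -- For `p m < 0` one extra zero makes the term vanish; otherwise the term has the right sign
        -- already and `K m / 2` zeros suffice.
        split_ifs with h
        · exact Or.inl (by omega)
        · refine Or.inr ⟨j, by omega, by omega, ?_⟩
          rw [one_mul, hcr]
          exact mul_nonneg hr.le (not_lt.1 h)) (fun x => x < 0) (fun x hx => by linarith)
  obtain ⟨hp1, hp2⟩ : numPosEigenvalues G ≤ _ ∧ numPosEigenvalues G ≤ _ :=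
    hupper (-1) (fun m => calNPos (K m) (p m)) (fun m hm hle => by
      dsimp only [calNPos]
      by_cases hK : Odd (K m)
      · obtain ⟨j, hj⟩ := hK
        rw [if_pos ⟨j, hj⟩]
        exact Or.inl (by omega)
      · have hK' := Nat.not_odd_iff_even.1 hK
        obtain ⟨r, hr, hcr⟩ := hsign m hm hle hK'
        obtain ⟨j, hj⟩ := hK'
        rw [if_neg hK]
        split_ifs with h
        · exact Or.inl (by omega)
        · refine Or.inr ⟨j, by omega, by omega, ?_⟩
          rw [hcr]
          have := mul_nonneg hr.le (neg_nonneg.2 (not_lt.1 h))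
          linarith) (fun x => 0 < x) (fun x hx => by linarith)
  obtain ⟨n, hn⟩ := Cardinal.lt_aleph0.1 (hn1.trans_lt (Cardinal.natCast_lt_aleph0))
  obtain ⟨n', hn'⟩ := Cardinal.lt_aleph0.1 (hp1.trans_lt (Cardinal.natCast_lt_aleph0))
  rw [hn, hn'] at hlower
  rw [hn] at hn1 hn2
  rw [hn'] at hp1 hp2
  rw [hn, hn']
  have hsplit := sum_Icc_ite_eq (f := f) (by omega) hM (fun m => K m + 1) (fun m => K m + 1)
    fun m => K m + 1
  simp only [ite_self] at hsplit
  have hcal : ∑ m ∈ Finset.Icc f M₀, calNPos (K m) (p m) +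
      ∑ m ∈ Finset.Icc f M₀, calNNeg (K m) (p m) ≤ ∑ m ∈ Finset.Icc f M₀, (K m + 1) := by
    rw [← Finset.sum_add_distrib]
    exact Finset.sum_le_sum fun m _ => calNPos_add_calNNeg_le _ _
  have hcard : ∑ m ∈ Finset.Icc (M₀ + 1) (M₀ + M₁), (K m + 1) =
      ∑ m ∈ Finset.Icc (M₀ + 1) (M₀ + M₁), K m + M₁ := by
    rw [Finset.sum_add_distrib]
    simp
  norm_cast at hlower hn1 hn2 hp1 hp2 ⊢
  -- The bound for `N₋` through one half-plane, subtracted from `hlower`, bounds `N₊` from below by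
  -- the sum over the other, and vice versa. Equality of the two half-plane sums is thus not needed
  -- beforehand.
  omega
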